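/- **Setting.** Let $\varepsilon>0$, let $\mu$ be a Borel probability measure on $\mathbb{R}^{d_y}$ with support $\mathcal{U}$, and let $\nu$ be the law of a random pair $(X,Y)\in\mathbb{R}^{d_x}\times\mathbb{R}^{d_y}$. Let $\mathcal{X}$ and $\mathcal{Y}$ be the supports of $X$ and $Y$. Assume that $\mathcal{U},\mathcal{X},\mathcal{Y}$ are compact, $\mathbb{E}[X]=0$, and $\Sigma_X:=\mathbb{E}[XX^\top]$ is invertible. Put $c(u,y):=\|u-y\|^2/2$ with the Euclidean norm, $M_x:=\sup_{x\in\mathcal{X}}\|x\|$, $\|c\|_\infty:=\sup_{(u,y)\in\mathcal{U}\times\mathcal{Y}}c(u,y)$, and $$D(f,g,h):=\int f\,d\mu+\int h\,d\nu-\varepsilon\left(\int \exp\left(\frac{f(u)+\langle g(u),x\rangle+h(x,y)-c(u,y)}{\varepsilon}\right)d(\mu\otimes\nu)(u,x,y)-1\right),$$ with values in $[-\infty,\infty)$. Triplets maximizing $D$ over $L^1(\mu)\times L^1(\mu;\mathbb{R}^{d_x})\times L^1(\nu)$ are called dual potentials. **Proposition 2.1.** Let $(\bar f,\bar g,\bar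 h)$ be dual potentials with $\bar f:\mathcal{U}\to\mathbb{R}$, $\bar g:\mathcal{U}\to\mathbb{R}^{d_x}$ and $\bar h:\mathcal{X}\times\mathcal{Y}\to\mathbb{R}$ continuous, normalized by $\int\bar f\,d\mu=0$ and $\int\bar g\,d\mu=0$, where $\bar h$ is the version for which $$\bar h(x,y)=-\varepsilon\log\int\exp\left(\frac{\bar f(u)+\langle\bar g(u),x\rangle-c(u,y)}{\varepsilon}\right)d\mu(u)\qquad\text{for all }(x,y)\in\mathcal{X}\times\mathcal{Y}.$$ Then $$\|\bar f\|_\infty\le\|c\|_\infty,\qquad \|\bar g\|_\infty\le 2\,\|\Sigma_X^{-1}\|_{\mathrm{op}}\,M_x\left(\frac52\|c\|_\infty+\varepsilon\log\left(\frac32\right)\right),\qquad \|\bar h\|_\infty\le\|c\|_\infty+\|\bar g\|_\infty M_x,$$ where $\|\bar f\|_\infty=\sup_{\mathcal{U}}|\bar f|$, $\|\bar g\|_\infty=\sup_{\mathcal{U}}\|\bar g\|$, $\|\bar h\|_\infty=\sup_{\mathcal{X}\times\mathcal{Y}}|\bar h|$, and $\|\cdot\|_{\mathrm{op}}$ is the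 operator norm with respect to the Euclidean norm. -/

import Mathlib

open MeasureTheory
open scoped ENNReal

noncomputable section

namespace VQR

/-- `ℝ^d` with the standard Euclidean norm and inner product. -/
abbrev Vec (d : ℕ) : Type := EuclideanSpace ℝ (Fin d)

/-- The ground cost `c(u, y) = ‖u - y‖² / 2`. -/
def cost {dy : ℕ} (u y : Vec dy) : ℝ := ‖u - y‖ ^ 2 / 2

/-- The support `𝒳` of the covariate `X`, where `ν` is the law of `(X, Y)`. -/
def supportX {dx dy : ℕ} (ν : Measure (Vec dx × Vec dy)) : Set (Vec dx) := ν.fst.support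

/-- The support `𝒴` of the response `Y`, where `ν` is the law of `(X, Y)`. -/
def supportY {dx dy : ℕ} (ν : Measure (Vec dx × Vec dy)) : Set (Vec dy) := ν.snd.support

/-- The second moment matrix `Σ_X = E[X Xᵀ]`. -/
def secondMoment {dx dy : ℕ} (ν : Measure (Vec dx × Vec dy)) : Matrix (Fin dx) (Fin dx) ℝ :=
  Matrix.of fun i j => ∫ p, p.1 i * p.1 j ∂ν

/-- The operator norm of a matrix acting on Euclidean space. -/
def opNorm {d : ℕ} (A : Matrix (Fin d) (Fin d) ℝ) : ℝ :=
  ‖Matrix.toEuclideanCLM (n := Fin d) (𝕜 := ℝ) A‖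

/-- `sup_{z ∈ S} ‖F z‖`. It is used only for functions continuous on a nonempty compact set `S`,
for which the supremum is that of a nonempty bounded set of reals. -/
def supNorm {α E : Type*} [Norm E] (S : Set α) (F : α → E) : ℝ := ⨆ z : S, ‖F z‖

/-- `M_x = sup_{x ∈ 𝒳} ‖x‖`. -/
def boundX {dx dy : ℕ} (ν : Measure (Vec dx × Vec dy)) : ℝ :=
  ⨆ x : supportX ν, ‖(x : Vec dx)‖

/-- `‖c‖_∞ = sup_{(u, y) ∈ 𝒰 × 𝒴} c(u, y)`, where `𝒰` is the support of `μ`. -/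
def costSup {dx dy : ℕ} (μ : Measure (Vec dy)) (ν : Measure (Vec dx × Vec dy)) : ℝ :=
  ⨆ z : (μ.support ×ˢ supportY ν : Set (Vec dy × Vec dy)), cost z.1.1 z.1.2

/-- `ι(f, g, h)`: the integral over `(u, (x, y))` of
`exp ((f(u) + ⟨g(u), x⟩ + h(x, y) - c(u, y)) / ε)` against `μ ⊗ ν`, as a number in `[0, ∞]`. -/
def iota {dx dy : ℕ} (ε : ℝ) (μ : Measure (Vec dy)) (ν : Measure (Vec dx × Vec dy))
    (f : Vec dy → ℝ) (g : Vec dy → Vec dx) (h : Vec dx × Vec dy → ℝ) : ℝ≥0∞ :=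
  ∫⁻ z, ENNReal.ofReal
    (Real.exp ((f z.1 + inner ℝ (g z.1) z.2.1 + h z.2 - cost z.1 z.2.2) / ε)) ∂(μ.prod ν)

/-- The dual objective `D(f, g, h) = ∫ f dμ + ∫ h dν - ε (ι(f, g, h) - 1)`; its value is `-∞`
when `ι(f, g, h) = ∞`. -/
def dualObjective {dx dy : ℕ} (ε : ℝ) (μ : Measure (Vec dy)) (ν : Measure (Vec dx × Vec dy))
    (f : Vec dy → ℝ) (g : Vec dy → Vec dx) (h : Vec dx × Vec dy → ℝ) : EReal :=
  ((∫ u, f u ∂μ + ∫ p, h p ∂ν : ℝ) : EReal) - (ε : EReal) * ((iota ε μ ν f g h : EReal) - 1)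

/-- `(f, g, h)` are dual potentials: they attain the supremum of the dual objective over
`L¹(μ) × L¹(μ; ℝ^dx) × L¹(ν)`. -/
def IsDualPotentials {dx dy : ℕ} (ε : ℝ) (μ : Measure (Vec dy)) (ν : Measure (Vec dx × Vec dy))
    (f : Vec dy → ℝ) (g : Vec dy → Vec dx) (h : Vec dx × Vec dy → ℝ) : Prop :=
  (Integrable f μ ∧ Integrable g μ ∧ Integrable h ν) ∧
    ∀ (f' : Vec dy → ℝ) (g' : Vec dy → Vec dx) (h' : Vec dx × Vec dy → ℝ),
      Integrable f' μ → Integrable g' μ → Integrable h' ν →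
        dualObjective ε μ ν f' g' h' ≤ dualObjective ε μ ν f g h

end VQR

end

/-! Write `w(u, ·)` for `logDensity` at `u`. Perturbing `f` and `g` on measurable sets, and then
using continuity, shows that for every `u ∈ 𝒰` the function `exp w(u, ·)` is a probability density
for `ν` under which `X` is centered (`IsDualPotentials.integral_exp_mul_eq`). With `C = ‖c‖_∞`,
Jensen and the normalization give `h ≤ C`, and comparison with `(0, 0, 0)` gives `∫ h dν ≥ 0`.

The bounds on `f` and `g` are entropy inequalities at a fixed `u`. The relative entropy of `exp w(u,
·)` is nonnegative; the term in `g` integrates to zero, so `h ≤ C` leaves `f(u) ≥ -C`. Conversely,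
Gibbs' inequality is tested against `q = 1 + ⟨b, x⟩` with `|⟨b, x⟩| ≤ r < 1`, a density because
`E[X] = 0`; it gives `f(u) + ⟨g(u), Σ_X b⟩ ≤ (1 + r) C + ε log (1 + r)`
(`add_inner_secondMoment_le`). Taking `b = 0` bounds `f` above; taking `b` along `Σ_X⁻¹ g(u)` with
`r = 1/2` bounds `g`. The lower bound on `h` is then read off its log-integral formula. -/

namespace VQR

/-! ### Tilting, entropy and Jensen inequalities on general measure spaces -/

/-- First-order condition for the exponential tilt `t ↦ t a - ε ∫ P exp (t k / ε)`. -/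
lemma eq_integral_mul_of_tilt_le {Z : Type*} [MeasurableSpace Z] {ρ : Measure Z}
    {P k : Z → ℝ} {ε a K : ℝ} (hε : 0 < ε) (hP : Integrable P ρ) (hP0 : ∀ z, 0 ≤ P z)
    (hk : AEStronglyMeasurable k ρ) (hK : ∀ᵐ z ∂ρ, |k z| ≤ K)
    (hopt : ∀ t : ℝ, t * a - ε * ∫ z, P z * Real.exp (t * k z / ε) ∂ρ ≤ -(ε * ∫ z, P z ∂ρ)) :
    a = ∫ z, P z * k z ∂ρ := by
  have hPk : Integrable (fun z => P z * k z) ρ :=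
    hP.mul_bdd hk (c := K) (by simpa using hK)
  set I := ∫ z, P z * k z ∂ρ with hI
  -- Second-order constant from `exp s ≤ 1 + s + s²` for `|s| ≤ 1`, applied to `s = t k / ε`.
  set C := (∫ z, P z ∂ρ) * K ^ 2 / ε with hC
  have key : ∀ t : ℝ, |t| * |K| ≤ ε → t * (a - I) - t ^ 2 * C ≤ 0 := by
    intro t ht
    have hKK : ∀ᵐ z ∂ρ, |k z| ≤ |K| := hK.mono fun z hz => hz.trans (le_abs_self K)
    have hle : ∫ z, P z * Real.exp (t * k z / ε) ∂ρ
        ≤ ∫ z, (P z + t / ε * (P z * k z) + (t / ε) ^ 2 * K ^ 2 * P z) ∂ρ := by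
      refine integral_mono_ae ?_ ?_ ?_
      · refine hP.mul_bdd (c := Real.exp 1) (by fun_prop) ?_
        filter_upwards [hKK] with z hz
        rw [Real.norm_eq_abs, Real.abs_exp, Real.exp_le_exp, div_le_one hε]
        refine (le_abs_self _).trans ?_
        rw [abs_mul]
        exact (mul_le_mul_of_nonneg_left hz (abs_nonneg _)).trans ht
      · exact (hP.add (hPk.const_mul _)).add (hP.const_mul _)
      · filter_upwards [hKK] with z hz
        have h1 : |t * k z / ε| ≤ 1 := by
          rw [abs_div, abs_of_pos hε, div_le_one hε, abs_mul]
          exact (mul_le_mul_of_nonneg_left hz (abs_nonneg _)).trans ht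
        have h2 := (abs_le.1 (Real.abs_exp_sub_one_sub_id_le h1)).2
        have h3 : (t * k z / ε) ^ 2 ≤ (t / ε) ^ 2 * K ^ 2 := by
          have : (t * k z / ε) ^ 2 = (t / ε) ^ 2 * k z ^ 2 := by ring
          rw [this]
          exact mul_le_mul_of_nonneg_left (sq_le_sq.2 hz) (sq_nonneg _)
        have h4 : Real.exp (t * k z / ε) ≤ 1 + t * k z / ε + (t / ε) ^ 2 * K ^ 2 := by linarith
        calc P z * Real.exp (t * k z / ε)
            ≤ P z * (1 + t * k z / ε + (t / ε) ^ 2 * K ^ 2) :=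
              mul_le_mul_of_nonneg_left h4 (hP0 z)
          _ = _ := by ring
    have hsum : ∫ z, (P z + t / ε * (P z * k z) + (t / ε) ^ 2 * K ^ 2 * P z) ∂ρ
        = (∫ z, P z ∂ρ) + t / ε * I + (t / ε) ^ 2 * K ^ 2 * ∫ z, P z ∂ρ := by
      have hsub : Integrable (fun z => P z + t / ε * (P z * k z)) ρ := hP.add (hPk.const_mul _)
      rw [integral_add hsub (hP.const_mul _),
        integral_add hP (hPk.const_mul _), integral_const_mul, integral_const_mul]
    rw [hsum] at hle
    have h5 := mul_le_mul_of_nonneg_left hle hε.le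
    have h6 : ε * ((∫ z, P z ∂ρ) + t / ε * I + (t / ε) ^ 2 * K ^ 2 * ∫ z, P z ∂ρ)
        = ε * (∫ z, P z ∂ρ) + t * I + t ^ 2 * C := by
      rw [hC]; field_simp
    linarith [hopt t]
  -- By `key` this function of `t` is nonpositive near `0` and vanishes at `0`, so its derivative `a
  -- - I` there is zero.
  have hd : HasDerivAt (fun t : ℝ => t * (a - I) - t ^ 2 * C) (a - I) 0 := by
    have := ((hasDerivAt_id (0 : ℝ)).mul_const (a - I)).sub
      (((hasDerivAt_id (0 : ℝ)).pow 2).mul_const C)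
    refine (this.congr_deriv (by simp)).congr_of_eventuallyEq (Filter.Eventually.of_forall ?_)
    intro t
    simp
  have hmax : IsLocalMax (fun t : ℝ => t * (a - I) - t ^ 2 * C) 0 := by
    have hcont : Continuous fun t : ℝ => |t| * |K| := by fun_prop
    have : ∀ᶠ t in nhds (0 : ℝ), |t| * |K| < ε :=
      hcont.continuousAt.eventually (Iio_mem_nhds (by simpa using hε))
    filter_upwards [this] with t ht
    simpa using key t ht.le
  linarith [hmax.hasDerivAt_eq_zero hd]

/-- Gibbs variational inequality for a density `exp w` and a competitor `q` with `log q ≤ L`. -/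
lemma integral_mul_le_of_log_le {Ω : Type*} [MeasurableSpace Ω] {ν : Measure Ω}
    {q w : Ω → ℝ} {L : ℝ} (hq : Integrable q ν) (hqw : Integrable (fun p => q p * w p) ν)
    (hw : Integrable (fun p => Real.exp (w p)) ν) (hq0 : ∀ᵐ p ∂ν, 0 < q p)
    (hqL : ∀ᵐ p ∂ν, Real.log (q p) ≤ L) (hq1 : ∫ p, q p ∂ν = 1)
    (hw1 : ∫ p, Real.exp (w p) ∂ν = 1) : ∫ p, q p * w p ∂ν ≤ L := by
  have hle : ∫ p, q p * w p ∂ν ≤ ∫ p, (L * q p + Real.exp (w p) - q p) ∂ν := by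
    refine integral_mono_ae hqw (((hq.const_mul L).add hw).sub hq) ?_
    filter_upwards [hq0, hqL] with p h0 hL
    -- Multiplied by `q`, this reads `q w ≤ q log q + exp w - q`; the last two terms cancel after
    -- integration.
    have h1 := Real.add_one_le_exp (w p - Real.log (q p))
    rw [Real.exp_sub, Real.exp_log h0, le_div_iff₀ h0] at h1
    have h2 := mul_le_mul_of_nonneg_right hL h0.le
    nlinarith
  have hsub : Integrable (fun p => L * q p + Real.exp (w p)) ν := (hq.const_mul L).add hw
  rw [integral_sub hsub hq, integral_add (hq.const_mul L) hw,
    integral_const_mul, hq1, hw1] at hle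
  linarith

/-- The relative entropy of a probability density `exp w` is nonnegative. -/
lemma integral_exp_mul_self_nonneg {Ω : Type*} [MeasurableSpace Ω] {ν : Measure Ω}
    [IsProbabilityMeasure ν] {w : Ω → ℝ} (hw : Integrable (fun p => Real.exp (w p)) ν)
    (hww : Integrable (fun p => Real.exp (w p) * w p) ν)
    (hw1 : ∫ p, Real.exp (w p) ∂ν = 1) : 0 ≤ ∫ p, Real.exp (w p) * w p ∂ν := by
  have hle : ∫ p, (Real.exp (w p) - 1) ∂ν ≤ ∫ p, Real.exp (w p) * w p ∂ν := by
    refine integral_mono (hw.sub (integrable_const 1)) hww fun p => ?_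
    have h1 := Real.add_one_le_exp (-w p)
    have h2 := mul_le_mul_of_nonneg_left h1 (Real.exp_pos (w p)).le
    rw [← Real.exp_add, add_neg_cancel, Real.exp_zero] at h2
    simp only
    linarith
  rw [integral_sub hw (integrable_const 1), hw1] at hle
  simpa using hle

/-- Jensen's inequality for the log-partition function. -/
lemma neg_mul_log_integral_exp_le {Ω : Type*} [MeasurableSpace Ω] {μ : Measure Ω}
    [IsProbabilityMeasure μ] {k : Ω → ℝ} {ε : ℝ} (hε : 0 < ε) (hk : Integrable k μ)
    (hek : Integrable (fun u => Real.exp (k u / ε)) μ) :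
    -ε * Real.log (∫ u, Real.exp (k u / ε) ∂μ) ≤ -∫ u, k u ∂μ := by
  have h1 : Real.exp (∫ u, k u / ε ∂μ) ≤ ∫ u, Real.exp (k u / ε) ∂μ :=
    convexOn_exp.map_integral_le Real.continuous_exp.continuousOn isClosed_univ
      (by simp) (hk.div_const ε) hek
  have h2 := (Real.le_log_iff_exp_le ((Real.exp_pos _).trans_le h1)).2 h1
  rw [integral_div, div_le_iff₀ hε] at h2
  linarith

/-- Two functions which are continuous on the support and agree almost everywhere agree on it. -/
lemma eqOn_support_of_ae_eq {X Y : Type*} [TopologicalSpace X] [HereditarilyLindelofSpace X]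
    [MeasurableSpace X] [TopologicalSpace Y] [T1Space Y] {μ : Measure X} {G : X → Y} {a : Y}
    (hG : ContinuousOn G μ.support) (hae : ∀ᵐ x ∂μ, G x = a) : ∀ x ∈ μ.support, G x = a := by
  intro x hx
  by_contra hne
  have h1 : ∀ᶠ y in nhdsWithin x μ.support, G y ≠ a :=
    (hG x hx).eventually (isOpen_ne.mem_nhds hne)
  obtain ⟨O, hO, hOsub⟩ := mem_nhdsWithin_iff_exists_mem_nhds_inter.1 h1
  have h2 := (Measure.mem_support_iff_forall x).1 hx O hO
  refine h2.ne' (measure_mono_null (t := {y | ¬ (G y = a ∧ y ∈ μ.support)}) ?_ ?_)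
  · rintro y hy ⟨hya, hys⟩
    exact hOsub ⟨hy, hys⟩ hya
  · exact hae.and Measure.support_mem_ae

/-! ### First-order conditions for the dual problem -/

/-- The logarithm of the density of the coupling attached to `(f, g, h)`. -/
noncomputable def logDensity {dx dy : ℕ} (ε : ℝ) (f : Vec dy → ℝ) (g : Vec dy → Vec dx)
    (h : Vec dx × Vec dy → ℝ) (z : Vec dy × (Vec dx × Vec dy)) : ℝ :=
  (f z.1 + inner ℝ (g z.1) z.2.1 + h z.2 - cost z.1 z.2.2) / ε

variable {dx dy : ℕ} {ε : ℝ} {μ : Measure (Vec dy)} {ν : Measure (Vec dx × Vec dy)}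
  {f : Vec dy → ℝ} {g : Vec dy → Vec dx} {h : Vec dx × Vec dy → ℝ}

lemma continuous_cost : Continuous fun z : Vec dy × Vec dy => cost z.1 z.2 := by
  unfold cost; fun_prop

lemma aestronglyMeasurable_logDensity [SFinite μ] [SFinite ν] (hf : AEStronglyMeasurable f μ)
    (hg : AEStronglyMeasurable g μ) (hh : AEStronglyMeasurable h ν) :
    AEStronglyMeasurable (logDensity ε f g h) (μ.prod ν) := by
  have hx : AEStronglyMeasurable (fun z : Vec dy × (Vec dx × Vec dy) => z.2.1) (μ.prod ν) :=
    (by fun_prop : Continuous fun z : Vec dy × (Vec dx × Vec dy) => z.2.1).aestronglyMeasurable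
  have hc : AEStronglyMeasurable (fun z : Vec dy × (Vec dx × Vec dy) => cost z.1 z.2.2)
      (μ.prod ν) :=
    (continuous_cost.comp (by fun_prop :
      Continuous fun z : Vec dy × (Vec dx × Vec dy) => (z.1, z.2.2))).aestronglyMeasurable
  have := (((hf.comp_fst (ν := ν)).add ((hg.comp_fst (ν := ν)).inner (𝕜 := ℝ) hx)).add
    (hh.comp_snd (μ := μ))).sub hc
  exact (this.mul_const ε⁻¹).congr (Filter.Eventually.of_forall fun z => by
    simp [logDensity, div_eq_mul_inv])

/-- Sections of a jointly a.e. measurable function are controlled only for almost every `u`; the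
pointwise argument needs every `u`. -/
lemma aestronglyMeasurable_logDensity_right (hh : AEStronglyMeasurable h ν) (u : Vec dy) :
    AEStronglyMeasurable (fun p => logDensity ε f g h (u, p)) ν := by
  have h1 : Continuous fun p : Vec dx × Vec dy => f u + inner ℝ (g u) p.1 := by fun_prop
  have h2 : Continuous fun p : Vec dx × Vec dy => cost u p.2 := by unfold cost; fun_prop
  exact (((h1.aestronglyMeasurable.add hh).sub h2.aestronglyMeasurable).mul_const ε⁻¹).congr
    (Filter.Eventually.of_forall fun z => by simp [logDensity, div_eq_mul_inv])

/-- Brings the optimality inequality from `EReal` down to `ℝ` whenever the exponential is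
integrable. -/
lemma dualObjective_eq_coe (hint : Integrable (fun z => Real.exp (logDensity ε f g h z))
      (μ.prod ν)) :
    dualObjective ε μ ν f g h = ((∫ u, f u ∂μ + ∫ p, h p ∂ν
      - ε * ((∫ z, Real.exp (logDensity ε f g h z) ∂(μ.prod ν)) - 1) : ℝ) : EReal) := by
  have h1 : iota ε μ ν f g h
      = ENNReal.ofReal (∫ z, Real.exp (logDensity ε f g h z) ∂(μ.prod ν)) :=
    (ofReal_integral_eq_lintegral_ofReal hint
      (Filter.Eventually.of_forall fun z => (Real.exp_pos _).le)).symm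
  have h2 : 0 ≤ ∫ z, Real.exp (logDensity ε f g h z) ∂(μ.prod ν) :=
    integral_nonneg fun z => (Real.exp_pos _).le
  unfold dualObjective
  rw [h1, EReal.coe_ennreal_ofReal, max_eq_left h2]
  push_cast
  rfl

/-- First-order condition for dual potentials, in weak form. -/
lemma IsDualPotentials.mul_real_eq_integral [IsProbabilityMeasure μ] [IsProbabilityMeasure ν]
    (hε : 0 < ε) (hdual : IsDualPotentials ε μ ν f g h)
    (hint : Integrable (fun z => Real.exp (logDensity ε f g h z)) (μ.prod ν))
    {M : ℝ} (hM : ∀ᵐ p ∂ν, ‖p.1‖ ≤ M) {E : Set (Vec dy)} (hE : MeasurableSet E)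
    (a : ℝ) (v : Vec dx) :
    μ.real E * a = ∫ z, Real.exp (logDensity ε f g h z)
      * E.indicator (fun _ => a + inner ℝ v z.2.1) z.1 ∂(μ.prod ν) := by
  obtain ⟨⟨hf, hg, hh⟩, hopt⟩ := hdual
  -- Moving `f` by `t a` and `g` by `t v` on `E` multiplies the density by `exp (t k / ε)`.
  set k : Vec dy × (Vec dx × Vec dy) → ℝ :=
    fun z => E.indicator (fun _ => a + inner ℝ v z.2.1) z.1 with hk
  have hkm : AEStronglyMeasurable k (μ.prod ν) := by
    have h0 : Continuous fun z : Vec dy × (Vec dx × Vec dy) => a + inner ℝ v z.2.1 := by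
      fun_prop
    exact (h0.aestronglyMeasurable (μ := μ.prod ν)).indicator (measurable_fst hE)
  have hkb : ∀ᵐ z ∂(μ.prod ν), |k z| ≤ |a| + ‖v‖ * |M| := by
    have h1 : ∀ᵐ z ∂(μ.prod ν), ‖z.2.1‖ ≤ M := Measure.quasiMeasurePreserving_snd.ae hM
    filter_upwards [h1] with z hz
    have h2 : |a + inner ℝ v z.2.1| ≤ |a| + ‖v‖ * |M| :=
      (abs_add_le _ _).trans (add_le_add le_rfl ((abs_real_inner_le_norm _ _).trans
        (mul_le_mul_of_nonneg_left (hz.trans (le_abs_self M)) (norm_nonneg _))))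
    by_cases hzE : z.1 ∈ E
    · simpa [hk, hzE] using h2
    · simpa [hk, hzE] using (by positivity : 0 ≤ |a| + ‖v‖ * |M|)
  refine eq_integral_mul_of_tilt_le hε hint (fun z => (Real.exp_pos _).le) hkm hkb fun t => ?_
  set f' : Vec dy → ℝ := fun u => f u + E.indicator (fun _ => t * a) u with hf'
  set g' : Vec dy → Vec dx := fun u => g u + E.indicator (fun _ => t • v) u with hg'
  have hfi : Integrable (E.indicator fun _ => t * a) μ := (integrable_const _).indicator hE
  have hgi : Integrable (E.indicator fun _ => t • v) μ := (integrable_const _).indicator hE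
  have hlog : ∀ z, Real.exp (logDensity ε f' g' h z)
      = Real.exp (logDensity ε f g h z) * Real.exp (t * k z / ε) := by
    intro z
    rw [← Real.exp_add]
    congr 1
    by_cases hzE : z.1 ∈ E
    · simp only [logDensity, hf', hg', hk, Set.indicator_of_mem hzE, inner_add_left,
        real_inner_smul_left]
      ring
    · simp only [logDensity, hf', hg', hk, Set.indicator_of_notMem hzE, add_zero]
      ring
  have hint' : Integrable (fun z => Real.exp (logDensity ε f' g' h z)) (μ.prod ν) := by
    simp only [hlog]
    refine hint.mul_bdd (c := Real.exp (|t| * (|a| + ‖v‖ * |M|) / ε)) (by fun_prop) ?_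
    filter_upwards [hkb] with z hz
    rw [Real.norm_eq_abs, Real.abs_exp, Real.exp_le_exp]
    refine div_le_div_of_nonneg_right ((le_abs_self _).trans ?_) hε.le
    rw [abs_mul]
    exact mul_le_mul_of_nonneg_left hz (abs_nonneg _)
  have h1 := hopt f' g' h (hf.add hfi) (hg.add hgi) hh
  rw [dualObjective_eq_coe hint, dualObjective_eq_coe hint', EReal.coe_le_coe_iff] at h1
  have h2 : ∫ u, f' u ∂μ = ∫ u, f u ∂μ + μ.real E * (t * a) := by
    rw [hf', integral_add hf hfi, integral_indicator hE, setIntegral_const, smul_eq_mul]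
  simp only [hlog, h2] at h1
  linarith

/-- The product of the marginal supports carries `ν`, although it may exceed the support of `ν`; it
is the compact set on which everything is bounded. -/
lemma ae_mem_supports :
    ∀ᵐ p ∂ν, p ∈ supportX ν ×ˢ supportY ν := by
  have h1 : ∀ᵐ p ∂ν, p.1 ∈ ν.fst.support :=
    ae_of_ae_map measurable_fst.aemeasurable (Measure.support_mem_ae (μ := ν.fst))
  have h2 : ∀ᵐ p ∂ν, p.2 ∈ ν.snd.support :=
    ae_of_ae_map measurable_snd.aemeasurable (Measure.support_mem_ae (μ := ν.snd))
  filter_upwards [h1, h2] with p hp1 hp2 using ⟨hp1, hp2⟩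

lemma continuousOn_logDensity {U : Set (Vec dy)} {S : Set (Vec dx × Vec dy)}
    (hf : ContinuousOn f U) (hg : ContinuousOn g U) (hh : ContinuousOn h S) :
    ContinuousOn (logDensity ε f g h) (U ×ˢ S) := by
  have h1 : Set.MapsTo Prod.fst (U ×ˢ S) U := fun z hz => hz.1
  have h2 : Set.MapsTo Prod.snd (U ×ˢ S) S := fun z hz => hz.2
  have hc : Continuous fun z : Vec dy × (Vec dx × Vec dy) => cost z.1 z.2.2 := by
    unfold cost; fun_prop
  have hx : Continuous fun z : Vec dy × (Vec dx × Vec dy) => z.2.1 := by fun_prop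
  have hf' : ContinuousOn (fun z : Vec dy × (Vec dx × Vec dy) => f z.1) (U ×ˢ S) :=
    hf.comp continuousOn_fst h1
  have hg' : ContinuousOn (fun z : Vec dy × (Vec dx × Vec dy) => g z.1) (U ×ˢ S) :=
    hg.comp continuousOn_fst h1
  have hh' : ContinuousOn (fun z : Vec dy × (Vec dx × Vec dy) => h z.2) (U ×ˢ S) :=
    hh.comp continuousOn_snd h2
  have hi : ContinuousOn (fun z : Vec dy × (Vec dx × Vec dy) => inner ℝ (g z.1) z.2.1)
      (U ×ˢ S) := hg'.inner hx.continuousOn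
  unfold logDensity
  exact (((hf'.add hi).add hh').sub hc.continuousOn).div_const ε

/-- First-order condition for continuous dual potentials: for every `u` in the support of `μ`,
`exp (logDensity (u, ·))` is a probability density under which `X` is centered. -/
lemma IsDualPotentials.integral_exp_mul_eq [IsProbabilityMeasure μ] [IsProbabilityMeasure ν]
    (hε : 0 < ε) (hU : IsCompact μ.support) (hX : IsCompact (supportX ν))
    (hY : IsCompact (supportY ν)) (hfc : ContinuousOn f μ.support) (hgc : ContinuousOn g μ.support)
    (hhc : ContinuousOn h (supportX ν ×ˢ supportY ν)) (hdual : IsDualPotentials ε μ ν f g h)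
    (a : ℝ) (v : Vec dx) {u : Vec dy} (hu : u ∈ μ.support) :
    ∫ p, Real.exp (logDensity ε f g h (u, p)) * (a + inner ℝ v p.1) ∂ν = a := by
  have hcont := continuousOn_logDensity (ε := ε) hfc hgc hhc
  obtain ⟨B, hB⟩ := (hU.prod (hX.prod hY)).exists_bound_of_continuousOn hcont
  obtain ⟨M, hM⟩ := hX.exists_bound_of_continuousOn (f := fun x => x) continuousOn_id
  have hm := aestronglyMeasurable_logDensity (ε := ε) hdual.1.1.1 hdual.1.2.1.1 hdual.1.2.2.1
  have hint : Integrable (fun z => Real.exp (logDensity ε f g h z)) (μ.prod ν) := by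
    refine Integrable.of_bound (Real.continuous_exp.comp_aestronglyMeasurable hm) (Real.exp B) ?_
    have h1 : ∀ᵐ z ∂(μ.prod ν), z.1 ∈ μ.support :=
      Measure.quasiMeasurePreserving_fst.ae Measure.support_mem_ae
    have h2 : ∀ᵐ z ∂(μ.prod ν), z.2 ∈ supportX ν ×ˢ supportY ν :=
      Measure.quasiMeasurePreserving_snd.ae ae_mem_supports
    filter_upwards [h1, h2] with z hz1 hz2
    rw [Real.norm_eq_abs, Real.abs_exp, Real.exp_le_exp]
    exact (le_abs_self _).trans (hB z ⟨hz1, hz2⟩)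
  have hMae : ∀ᵐ p ∂ν, ‖p.1‖ ≤ M := ae_mem_supports.mono fun p hp => hM p.1 hp.1
  have hlin : Continuous fun p : Vec dx × Vec dy => a + inner ℝ v p.1 := by fun_prop
  have hlinb : ∀ p ∈ supportX ν ×ˢ supportY ν, |a + inner ℝ v p.1| ≤ |a| + ‖v‖ * M :=
    fun p hp => (abs_add_le _ _).trans (add_le_add le_rfl ((abs_real_inner_le_norm _ _).trans
        (mul_le_mul_of_nonneg_left (hM p.1 hp.1) (norm_nonneg _))))
  have hbd : ∀ u ∈ μ.support, ∀ p ∈ supportX ν ×ˢ supportY ν,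
      ‖Real.exp (logDensity ε f g h (u, p)) * (a + inner ℝ v p.1)‖
        ≤ Real.exp B * (|a| + ‖v‖ * M) := by
    intro u hu p hp
    rw [norm_mul, Real.norm_eq_abs, Real.norm_eq_abs, Real.abs_exp]
    exact mul_le_mul (Real.exp_le_exp.2 ((le_abs_self _).trans (hB (u, p) ⟨hu, hp⟩)))
      (hlinb p hp) (abs_nonneg _) (Real.exp_pos _).le
  have hmeas : ∀ u, AEStronglyMeasurable
      (fun p => Real.exp (logDensity ε f g h (u, p)) * (a + inner ℝ v p.1)) ν := by
    intro u
    exact (Real.continuous_exp.comp_aestronglyMeasurable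
      (aestronglyMeasurable_logDensity_right hdual.1.2.2.1 u)).mul hlin.aestronglyMeasurable
  -- Optimality yields the identity only for almost every `u`; continuity of the integral in `u`
  -- extends it to all of the support.
  have hGcont : ContinuousOn
      (fun u => ∫ p, Real.exp (logDensity ε f g h (u, p)) * (a + inner ℝ v p.1) ∂ν)
      μ.support := by
    refine continuousOn_of_dominated (bound := fun _ => Real.exp B * (|a| + ‖v‖ * M))
      (fun u _ => hmeas u) (fun u hu => ae_mem_supports.mono fun p hp => hbd u hu p hp)
      (integrable_const _) (ae_mem_supports.mono fun p hp => ?_)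
    have h1 : ContinuousOn (fun u => logDensity ε f g h (u, p)) μ.support :=
      hcont.comp (by fun_prop) fun u hu => ⟨hu, hp⟩
    exact (Real.continuous_exp.comp_continuousOn h1).mul continuousOn_const
  refine eqOn_support_of_ae_eq hGcont ?_ u hu
  have hprod : Integrable (fun z : Vec dy × (Vec dx × Vec dy) =>
      Real.exp (logDensity ε f g h z) * (a + inner ℝ v z.2.1)) (μ.prod ν) := by
    refine hint.mul_bdd (c := |a| + ‖v‖ * M)
      (hlin.comp continuous_snd).aestronglyMeasurable ?_
    exact Measure.quasiMeasurePreserving_snd.ae (ae_mem_supports.mono hlinb)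
  have hG := hprod.integral_prod_left
  -- Testing on every measurable `E` turns the weak first-order condition into an a.e. identity.
  refine hG.ae_eq_of_forall_setIntegral_eq _ _ (integrable_const a) fun E hE _ => ?_
  rw [setIntegral_const, smul_eq_mul, hdual.mul_real_eq_integral hε hint hMae hE a v,
    ← integral_indicator hE]
  have hind : ∀ z : Vec dy × (Vec dx × Vec dy), Real.exp (logDensity ε f g h z)
      * E.indicator (fun _ => a + inner ℝ v z.2.1) z.1
      = (Prod.fst ⁻¹' E).indicator (fun z : Vec dy × (Vec dx × Vec dy) =>
        Real.exp (logDensity ε f g h z) * (a + inner ℝ v z.2.1)) z := by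
    intro z
    by_cases hz : z.1 ∈ E <;> simp [hz]
  simp only [hind]
  rw [integral_prod _ (hprod.indicator (measurable_fst hE))]
  refine integral_congr_ae (Filter.Eventually.of_forall fun u => ?_)
  by_cases hu : u ∈ E <;> simp [hu]

/-! ### Suprema over supports and the second moment matrix -/

lemma cost_nonneg (u y : Vec dy) : 0 ≤ cost u y := by unfold cost; positivity

lemma norm_le_supNorm {α E : Type*} [TopologicalSpace α] [SeminormedAddCommGroup E] {S : Set α}
    (hS : IsCompact S) {F : α → E} (hF : ContinuousOn F S) {z : α} (hz : z ∈ S) :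
    ‖F z‖ ≤ supNorm S F := by
  obtain ⟨B, hB⟩ := hS.exists_bound_of_continuousOn hF
  exact le_ciSup (f := fun z : S => ‖F z‖) ⟨B, by rintro _ ⟨z, rfl⟩; exact hB z z.2⟩ ⟨z, hz⟩

lemma norm_le_boundX (hX : IsCompact (supportX ν)) {x : Vec dx} (hx : x ∈ supportX ν) :
    ‖x‖ ≤ boundX ν :=
  norm_le_supNorm hX (F := fun x => x) continuousOn_id hx

lemma cost_le_costSup (hU : IsCompact μ.support) (hY : IsCompact (supportY ν)) {u y : Vec dy}
    (hu : u ∈ μ.support) (hy : y ∈ supportY ν) : cost u y ≤ costSup μ ν := by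
  obtain ⟨B, hB⟩ := (hU.prod hY).exists_bound_of_continuousOn
    (continuous_cost (dy := dy)).continuousOn
  exact le_ciSup (f := fun z : (μ.support ×ˢ supportY ν : Set (Vec dy × Vec dy)) =>
    cost z.1.1 z.1.2) ⟨B, by rintro _ ⟨z, rfl⟩; exact (le_abs_self _).trans (hB z z.2)⟩
    ⟨(u, y), hu, hy⟩

/-- Continuous functions on a compact set carrying the measure are integrable. -/
lemma integrable_of_continuousOn_of_ae_mem {Ω E : Type*} [TopologicalSpace Ω] [MeasurableSpace Ω]
    [NormedAddCommGroup E] {ρ : Measure Ω} [IsFiniteMeasure ρ] {S : Set Ω} {F : Ω → E}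
    (hS : IsCompact S) (hmem : ∀ᵐ z ∂ρ, z ∈ S) (hF : ContinuousOn F S)
    (hm : AEStronglyMeasurable F ρ) : Integrable F ρ := by
  obtain ⟨B, hB⟩ := hS.exists_bound_of_continuousOn hF
  exact Integrable.of_bound hm B (hmem.mono fun z hz => hB z hz)

/-- The quadratic form of the second moment matrix. -/
lemma integral_inner_mul_inner [IsFiniteMeasure ν] (hX : IsCompact (supportX ν)) (b v : Vec dx) :
    ∫ p, inner ℝ b p.1 * inner ℝ v p.1 ∂ν
      = inner ℝ v (Matrix.toEuclideanCLM (n := Fin dx) (𝕜 := ℝ) (secondMoment ν) b) := by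
  have hij : ∀ i j : Fin dx, Integrable (fun p : Vec dx × Vec dy => p.1 i * p.1 j) ν := by
    intro i j
    have hc : Continuous fun p : Vec dx × Vec dy => p.1 i * p.1 j := by fun_prop
    refine Integrable.of_bound hc.aestronglyMeasurable (boundX ν * boundX ν) ?_
    filter_upwards [ae_mem_supports (ν := ν)] with p hp
    have hb := norm_le_boundX hX hp.1
    rw [norm_mul]
    exact mul_le_mul ((PiLp.norm_apply_le p.1 i).trans hb) ((PiLp.norm_apply_le p.1 j).trans hb)
      (norm_nonneg _) ((norm_nonneg _).trans hb)
  have h1 : ∀ p : Vec dx × Vec dy, inner ℝ b p.1 * inner ℝ v p.1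
      = ∑ i, ∑ j, v i * b j * (p.1 i * p.1 j) := by
    intro p
    simp only [PiLp.inner_apply, RCLike.inner_apply, conj_trivial]
    rw [mul_comm, Finset.sum_mul_sum]
    refine Finset.sum_congr rfl fun i _ => Finset.sum_congr rfl fun j _ => ?_
    ring
  simp only [h1]
  rw [integral_finsetSum _ fun i _ => integrable_finsetSum _ fun j _ => (hij i j).const_mul _]
  simp only [PiLp.inner_apply, RCLike.inner_apply, conj_trivial]
  refine Finset.sum_congr rfl fun i _ => ?_
  rw [integral_finsetSum _ fun j _ => (hij i j).const_mul _]
  simp only [Matrix.ofLp_toEuclideanCLM, Matrix.mulVec, dotProduct, secondMoment, Matrix.of_apply,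
    integral_const_mul, Finset.sum_mul]
  refine Finset.sum_congr rfl fun j _ => ?_
  ring

lemma integral_inner_fst_eq_zero [IsFiniteMeasure ν] (hX : IsCompact (supportX ν))
    (hmean : ∫ p, p.1 ∂ν = 0) (v : Vec dx) : ∫ p, inner ℝ v p.1 ∂ν = 0 := by
  have hi : Integrable (fun p : Vec dx × Vec dy => p.1) ν :=
    Integrable.of_bound continuous_fst.aestronglyMeasurable (boundX ν)
      (ae_mem_supports.mono fun p hp => norm_le_boundX hX hp.1)
  rw [integral_inner hi v, hmean, inner_zero_right]

/-- A lower bound `t ‖v‖² ≤ B` for all admissible step sizes `t` bounds `‖v‖`. -/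
lemma norm_le_of_forall_mul_sq_le {r K M B : ℝ} (hr : 0 ≤ r) (hK : 0 ≤ K) (hM : 0 ≤ M)
    (hB : 0 ≤ B) (H : ∀ t : ℝ, 0 ≤ t → t * (K * r) * M ≤ 1 / 2 → t * r ^ 2 ≤ B) :
    r ≤ 2 * K * M * B := by
  rcases hr.eq_or_lt with rfl | hr
  · positivity
  rcases (mul_nonneg hK hM).eq_or_lt with h0 | h0
  -- If `K M = 0`, every step size is admissible, and this one would give `B + 1 ≤ B`.
  · have h1 := H ((B + 1) / r ^ 2) (by positivity)
      (by rw [show (B + 1) / r ^ 2 * (K * r) * M = (B + 1) / r ^ 2 * r * (K * M) by ring, ← h0]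
          norm_num)
    rw [div_mul_cancel₀ _ (by positivity)] at h1
    linarith
  -- The largest admissible step, for which the constraint is an equality.
  · have h1 := H (1 / (2 * (K * M) * r)) (by positivity) (le_of_eq (by
      have : K ≠ 0 := fun h => by simp [h] at h0
      have : M ≠ 0 := fun h => by simp [h] at h0
      field_simp))
    have h2 : 1 / (2 * (K * M) * r) * r ^ 2 = r / (2 * (K * M)) := by field_simp
    rw [h2, div_le_iff₀ (by positivity)] at h1
    linarith

/-! ### Bounds on `h` and the sign of its integral -/

section Bounds

variable [IsProbabilityMeasure μ]

lemma costSup_nonneg [IsProbabilityMeasure ν] (hU : IsCompact μ.support) (hY : IsCompact (supportY ν)) :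
    0 ≤ costSup μ ν := by
  obtain ⟨u, hu⟩ := Measure.nonempty_support (IsProbabilityMeasure.ne_zero μ)
  obtain ⟨y, hy⟩ := Measure.nonempty_support (IsProbabilityMeasure.ne_zero ν.snd)
  exact (cost_nonneg u y).trans (cost_le_costSup hU hY hu hy)

lemma boundX_nonneg [IsProbabilityMeasure ν] (hX : IsCompact (supportX ν)) : 0 ≤ boundX ν := by
  obtain ⟨x, hx⟩ := Measure.nonempty_support (IsProbabilityMeasure.ne_zero ν.fst)
  exact (norm_nonneg x).trans (norm_le_boundX hX hx)

lemma integrable_potential (hU : IsCompact μ.support) (hfi : Integrable f μ)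
    (hgi : Integrable g μ) (x : Vec dx) (y : Vec dy) :
    Integrable (fun u => f u + inner ℝ (g u) x - cost u y) μ := by
  have hc : Continuous fun u : Vec dy => cost u y := by unfold cost; fun_prop
  exact (hfi.add (hgi.inner_const x)).sub (integrable_of_continuousOn_of_ae_mem hU
    Measure.support_mem_ae hc.continuousOn hc.aestronglyMeasurable)

lemma integrable_exp_potential (hU : IsCompact μ.support) (hfi : Integrable f μ)
    (hgi : Integrable g μ) (hfc : ContinuousOn f μ.support) (hgc : ContinuousOn g μ.support)
    (x : Vec dx) (y : Vec dy) :
    Integrable (fun u => Real.exp ((f u + inner ℝ (g u) x - cost u y) / ε)) μ := by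
  have hc : Continuous fun u : Vec dy => cost u y := by unfold cost; fun_prop
  refine integrable_of_continuousOn_of_ae_mem hU Measure.support_mem_ae ?_ ?_
  · exact Real.continuous_exp.comp_continuousOn
      (((hfc.add (hgc.inner continuousOn_const)).sub hc.continuousOn).div_const ε)
  · refine Real.continuous_exp.comp_aestronglyMeasurable ?_
    have := (integrable_potential hU hfi hgi x y).div_const ε
    exact this.1

/-- Upper bound for the potential `h`, from Jensen's inequality and the normalization. -/
lemma potential_le_costSup (hε : 0 < ε) (hU : IsCompact μ.support) (hY : IsCompact (supportY ν))
    (hfi : Integrable f μ) (hgi : Integrable g μ) (hfc : ContinuousOn f μ.support)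
    (hgc : ContinuousOn g μ.support) (hf0 : ∫ u, f u ∂μ = 0) (hg0 : ∫ u, g u ∂μ = 0)
    (x : Vec dx) {y : Vec dy} (hy : y ∈ supportY ν) :
    -ε * Real.log (∫ u, Real.exp ((f u + inner ℝ (g u) x - cost u y) / ε) ∂μ)
      ≤ costSup μ ν := by
  refine (neg_mul_log_integral_exp_le hε (integrable_potential hU hfi hgi x y)
    (integrable_exp_potential hU hfi hgi hfc hgc x y)).trans ?_
  have hc : Continuous fun u : Vec dy => cost u y := by unfold cost; fun_prop
  have hci : Integrable (fun u => cost u y) μ := integrable_of_continuousOn_of_ae_mem hU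
    Measure.support_mem_ae hc.continuousOn hc.aestronglyMeasurable
  have hin : ∫ u, inner ℝ (g u) x ∂μ = 0 := by
    have h1 : ∀ u, inner ℝ (g u) x = inner ℝ x (g u) := fun u => real_inner_comm _ _
    simp only [h1]
    rw [integral_inner hgi x, hg0, inner_zero_right]
  have hsub : Integrable (fun u => f u + inner ℝ (g u) x) μ := hfi.add (hgi.inner_const x)
  rw [integral_sub hsub hci, integral_add hfi (hgi.inner_const x), hf0, hin]
  have h2 : ∫ u, cost u y ∂μ ≤ ∫ _, costSup μ ν ∂μ := by
    refine integral_mono_ae hci (integrable_const _) ?_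
    have : ∀ᵐ u ∂μ, u ∈ μ.support := Measure.support_mem_ae
    filter_upwards [this] with u hu using cost_le_costSup hU hY hu hy
  simp at h2
  linarith

/-- Lower bound for the potential `h`. -/
lemma neg_le_potential (hε : 0 < ε) {B : ℝ} (hfi : Integrable f μ)
    (hgi : Integrable g μ) (hfc : ContinuousOn f μ.support) (hgc : ContinuousOn g μ.support)
    (hU : IsCompact μ.support) (x : Vec dx) (y : Vec dy)
    (hB : ∀ u ∈ μ.support, f u + inner ℝ (g u) x ≤ B) :
    -B ≤ -ε * Real.log (∫ u, Real.exp ((f u + inner ℝ (g u) x - cost u y) / ε) ∂μ) := by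
  have hi := integrable_exp_potential (ε := ε) hU hfi hgi hfc hgc x y
  have h1 : ∫ u, Real.exp ((f u + inner ℝ (g u) x - cost u y) / ε) ∂μ ≤ Real.exp (B / ε) := by
    have : ∫ u, Real.exp ((f u + inner ℝ (g u) x - cost u y) / ε) ∂μ
        ≤ ∫ _, Real.exp (B / ε) ∂μ := by
      refine integral_mono_ae hi (integrable_const _) ?_
      have : ∀ᵐ u ∂μ, u ∈ μ.support := Measure.support_mem_ae
      filter_upwards [this] with u hu
      refine Real.exp_le_exp.2 (div_le_div_of_nonneg_right ?_ hε.le)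
      linarith [hB u hu, cost_nonneg u y]
    simpa using this
  have h2 := Real.log_le_log (integral_exp_pos hi) h1
  rw [Real.log_exp, le_div_iff₀ hε] at h2
  linarith

/-- At continuous dual potentials the mass of the coupling is one, so that comparison with
`(0, 0, 0)` gives a sign. -/
lemma IsDualPotentials.integral_nonneg [IsProbabilityMeasure ν] (hε : 0 < ε)
    (hdual : IsDualPotentials ε μ ν f g h)
    (hint : Integrable (fun z => Real.exp (logDensity ε f g h z)) (μ.prod ν))
    (hf0 : ∫ u, f u ∂μ = 0)
    (hfoc : ∀ u ∈ μ.support, ∫ p, Real.exp (logDensity ε f g h (u, p)) ∂ν = 1) :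
    0 ≤ ∫ p, h p ∂ν := by
  have h1 : ∫ z, Real.exp (logDensity ε f g h z) ∂(μ.prod ν) = 1 := by
    rw [integral_prod _ hint]
    have : ∀ᵐ u ∂μ, u ∈ μ.support := Measure.support_mem_ae
    rw [integral_congr_ae (this.mono hfoc)]
    simp
  have hw0 : ∀ z, logDensity ε (0 : Vec dy → ℝ) (0 : Vec dy → Vec dx)
      (0 : Vec dx × Vec dy → ℝ) z = -cost z.1 z.2.2 / ε := by
    intro z; simp [logDensity]
  have hle : ∀ z, Real.exp (logDensity ε (0 : Vec dy → ℝ) (0 : Vec dy → Vec dx)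
      (0 : Vec dx × Vec dy → ℝ) z) ≤ 1 := by
    intro z
    rw [hw0, Real.exp_le_one_iff]
    exact div_nonpos_of_nonpos_of_nonneg (neg_nonpos.2 (cost_nonneg _ _)) hε.le
  have hint0 : Integrable (fun z => Real.exp (logDensity ε (0 : Vec dy → ℝ)
      (0 : Vec dy → Vec dx) (0 : Vec dx × Vec dy → ℝ) z)) (μ.prod ν) := by
    refine Integrable.of_bound (Real.continuous_exp.comp_aestronglyMeasurable
      (aestronglyMeasurable_logDensity aestronglyMeasurable_zero aestronglyMeasurable_zero
        aestronglyMeasurable_zero)) 1 (Filter.Eventually.of_forall fun z => ?_)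
    rw [Real.norm_eq_abs, Real.abs_exp]
    exact hle z
  have h2 : ∫ z, Real.exp (logDensity ε (0 : Vec dy → ℝ) (0 : Vec dy → Vec dx)
      (0 : Vec dx × Vec dy → ℝ) z) ∂(μ.prod ν) ≤ 1 := by
    have := integral_mono hint0 (integrable_const 1) hle
    simpa using this
  -- The optimal value reduces to `∫ h dν`, while `(0, 0, 0)` has nonnegative objective because the
  -- cost is nonnegative.
  have h3 := hdual.2 0 0 0 (integrable_zero _ _ _) (integrable_zero _ _ _) (integrable_zero _ _ _)
  rw [dualObjective_eq_coe hint, dualObjective_eq_coe hint0, EReal.coe_le_coe_iff, h1, hf0] at h3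
  simp only [Pi.zero_apply, integral_zero] at h3
  nlinarith

end Bounds

/-! ### Entropy inequalities at a fixed point of the support -/

/-- Lower bound for the potential `f` at a point where the conditional coupling is a centered
probability density. -/
lemma neg_le_of_moment_conditions [IsProbabilityMeasure ν] (hε : 0 < ε) {C : ℝ} {u : Vec dy}
    (hC : ∀ᵐ p ∂ν, h p ≤ C)
    (hw : Integrable (fun p => Real.exp (logDensity ε f g h (u, p))) ν)
    (hww : Integrable (fun p => Real.exp (logDensity ε f g h (u, p)) * logDensity ε f g h (u, p)) ν)
    (hwx : Integrable (fun p => Real.exp (logDensity ε f g h (u, p))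
      * (f u + C + inner ℝ (g u) p.1)) ν)
    (hfoc : ∀ (a : ℝ) (v : Vec dx),
      ∫ p, Real.exp (logDensity ε f g h (u, p)) * (a + inner ℝ v p.1) ∂ν = a) :
    -C ≤ f u := by
  have h1 : ∫ p, Real.exp (logDensity ε f g h (u, p)) ∂ν = 1 := by simpa using hfoc 1 0
  have h2 := integral_exp_mul_self_nonneg hw hww h1
  have h3 : ∫ p, Real.exp (logDensity ε f g h (u, p)) * logDensity ε f g h (u, p) ∂ν
      ≤ ∫ p, Real.exp (logDensity ε f g h (u, p)) * (f u + C + inner ℝ (g u) p.1) / ε ∂ν := by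
    refine integral_mono_ae hww (hwx.div_const ε) ?_
    filter_upwards [hC] with p hp
    rw [mul_div_assoc]
    refine mul_le_mul_of_nonneg_left (div_le_div_of_nonneg_right ?_ hε.le) (Real.exp_pos _).le
    simp only
    linarith [cost_nonneg u p.2]
  -- With `a = f u + C` and `v = g u`, centering removes the term in `g`.
  rw [integral_div, hfoc] at h3
  have h4 := mul_nonneg (h2.trans h3) hε.le
  rw [div_mul_cancel₀ _ hε.ne'] at h4
  linarith

/-- Gibbs' inequality against the density `1 + ⟨b, x⟩`. -/
lemma add_inner_secondMoment_le [IsProbabilityMeasure ν] (hε : 0 < ε)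
    (hX : IsCompact (supportX ν)) (hmean : ∫ p, p.1 ∂ν = 0) {C r : ℝ} {u : Vec dy} {b : Vec dx}
    (hr0 : 0 ≤ r) (hr1 : r < 1) (hb : ∀ x ∈ supportX ν, |inner ℝ b x| ≤ r)
    (hhi : Integrable h ν) (hh0 : 0 ≤ ∫ p, h p ∂ν) (hC : ∀ᵐ p ∂ν, h p ≤ C)
    (hcC : ∀ᵐ p ∂ν, cost u p.2 ≤ C)
    (hw : Integrable (fun p => logDensity ε f g h (u, p)) ν)
    (hew : Integrable (fun p => Real.exp (logDensity ε f g h (u, p))) ν)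
    (hew1 : ∫ p, Real.exp (logDensity ε f g h (u, p)) ∂ν = 1) :
    f u + inner ℝ (g u) (Matrix.toEuclideanCLM (n := Fin dx) (𝕜 := ℝ) (secondMoment ν) b)
      ≤ (1 + r) * C + ε * Real.log (1 + r) := by
  have hbae : ∀ᵐ p ∂ν, |inner ℝ b p.1| ≤ r := ae_mem_supports.mono fun p hp => hb p.1 hp.1
  have hlin : ∀ v : Vec dx, Integrable (fun p : Vec dx × Vec dy => inner ℝ v p.1) ν := by
    intro v
    have hc : Continuous fun p : Vec dx × Vec dy => inner ℝ v p.1 := by fun_prop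
    refine Integrable.of_bound hc.aestronglyMeasurable (‖v‖ * boundX ν) ?_
    filter_upwards [ae_mem_supports (ν := ν)] with p hp
    exact (abs_real_inner_le_norm _ _).trans
      (mul_le_mul_of_nonneg_left (norm_le_boundX hX hp.1) (norm_nonneg _))
  have hq : Integrable (fun p : Vec dx × Vec dy => 1 + inner ℝ b p.1) ν :=
    (integrable_const 1).add (hlin b)
  have hbm : AEStronglyMeasurable (fun p : Vec dx × Vec dy => inner ℝ b p.1) ν := (hlin b).1
  have hqb : ∀ᵐ p ∂ν, ‖1 + inner ℝ b p.1‖ ≤ 1 + r := by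
    filter_upwards [hbae] with p hp
    have := abs_le.1 hp
    rw [Real.norm_eq_abs, abs_le]
    constructor <;> linarith
  have hqw : Integrable (fun p => (1 + inner ℝ b p.1) * logDensity ε f g h (u, p)) ν :=
    hw.bdd_mul hq.1 hqb
  have hgib := integral_mul_le_of_log_le (L := Real.log (1 + r)) hq hqw hew
    (hbae.mono fun p hp => by linarith [(abs_le.1 hp).1])
    (hbae.mono fun p hp => Real.log_le_log (by linarith [(abs_le.1 hp).1])
      (by linarith [(abs_le.1 hp).2]))
    (by rw [integral_add (integrable_const 1) (hlin b), integral_inner_fst_eq_zero hX hmean]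
        simp) hew1
  have hbg : Integrable (fun p : Vec dx × Vec dy => inner ℝ b p.1 * inner ℝ (g u) p.1) ν :=
    (hlin (g u)).bdd_mul hbm hbae
  have e1 : Integrable (fun p : Vec dx × Vec dy => f u * (1 + inner ℝ b p.1)) ν :=
    hq.const_mul _
  have e2 : Integrable (fun p : Vec dx × Vec dy => f u * (1 + inner ℝ b p.1)
      + inner ℝ (g u) p.1) ν := e1.add (hlin _)
  have e3 : Integrable (fun p : Vec dx × Vec dy => f u * (1 + inner ℝ b p.1)
      + inner ℝ (g u) p.1 + inner ℝ b p.1 * inner ℝ (g u) p.1) ν := e2.add hbg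
  have e4 : Integrable (fun p : Vec dx × Vec dy => (1 + r) * (C - h p)) ν :=
    ((integrable_const C).sub hhi).const_mul _
  -- With `q = 1 + ⟨b, x⟩`, `q (h - c) = q (C - c) - q (C - h) ≥ -(1 + r) (C - h)`, since `0 ≤ q ≤ 1
  -- + r`, `c ≤ C` and `h ≤ C`. Thus `h` survives only through `∫ h dν ≥ 0`.
  have hlow : ∫ p, (f u * (1 + inner ℝ b p.1) + inner ℝ (g u) p.1
        + inner ℝ b p.1 * inner ℝ (g u) p.1 - (1 + r) * (C - h p)) ∂ν
      ≤ ∫ p, ε * ((1 + inner ℝ b p.1) * logDensity ε f g h (u, p)) ∂ν := by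
    refine integral_mono_ae (e3.sub e4) (hqw.const_mul ε) ?_
    filter_upwards [hbae, hC, hcC] with p hp hpC hpc
    have hp' := abs_le.1 hp
    have h1 : ε * ((1 + inner ℝ b p.1) * logDensity ε f g h (u, p))
        = (1 + inner ℝ b p.1) * (f u + inner ℝ (g u) p.1 + h p - cost u p.2) := by
      simp only [logDensity]; field_simp
    rw [h1]
    have h2 : 0 ≤ (1 + inner ℝ b p.1) * (C - cost u p.2) :=
      mul_nonneg (by linarith) (by linarith)
    have h3 : 0 ≤ (r - inner ℝ b p.1) * (C - h p) := mul_nonneg (by linarith) (by linarith)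
    linarith
  rw [integral_const_mul, integral_sub e3 e4, integral_add e2 hbg, integral_add e1 (hlin _),
    integral_const_mul, integral_add (integrable_const 1) (hlin b),
    integral_inner_fst_eq_zero hX hmean, integral_inner_fst_eq_zero hX hmean,
    integral_inner_mul_inner hX, integral_const_mul,
    integral_sub (integrable_const C) hhi] at hlow
  simp only [integral_const, probReal_univ, smul_eq_mul] at hlow
  have h4 := mul_le_mul_of_nonneg_left hgib hε.le
  have h5 : 0 ≤ (1 + r) * ∫ p, h p ∂ν := mul_nonneg (by linarith) hh0
  linarith

end VQR

/-! ### The three sup-norm bounds -/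

theorem proposition2p1 {dx dy : ℕ} (ε : ℝ) (hε : 0 < ε)
    (μ : Measure (VQR.Vec dy)) [IsProbabilityMeasure μ]
    -- the law of the pair `(X, Y)`
    (ν : Measure (VQR.Vec dx × VQR.Vec dy)) [IsProbabilityMeasure ν]
    -- compact supports, `E[X] = 0` and invertible `E[X Xᵀ]`
    (hU : IsCompact μ.support) (hX : IsCompact (VQR.supportX ν)) (hY : IsCompact (VQR.supportY ν))
    (hmean : ∫ p, p.1 ∂ν = 0) (hSigma : IsUnit (VQR.secondMoment ν))
    (f : VQR.Vec dy → ℝ) (g : VQR.Vec dy → VQR.Vec dx) (h : VQR.Vec dx × VQR.Vec dy → ℝ)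
    -- the triplet lies in `𝒞(𝒰) × 𝒞(𝒰; ℝ^dx) × 𝒞(𝒳 × 𝒴)`
    (hfc : ContinuousOn f μ.support) (hgc : ContinuousOn g μ.support)
    (hhc : ContinuousOn h (VQR.supportX ν ×ˢ VQR.supportY ν))
    -- normalization
    (hf0 : ∫ u, f u ∂μ = 0) (hg0 : ∫ u, g u ∂μ = 0)
    (hdual : VQR.IsDualPotentials ε μ ν f g h)
    -- choice of the version of `h` on all of `𝒳 × 𝒴`, which may be larger than the support of `ν`
    (hver : ∀ x ∈ VQR.supportX ν, ∀ y ∈ VQR.supportY ν,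
      h (x, y) = -ε * Real.log (∫ u, Real.exp ((f u + inner ℝ (g u) x - VQR.cost u y) / ε) ∂μ)) :
    VQR.supNorm μ.support f ≤ VQR.costSup μ ν ∧
    VQR.supNorm μ.support g ≤
      2 * VQR.opNorm (VQR.secondMoment ν)⁻¹ * VQR.boundX ν *
        (5 / 2 * VQR.costSup μ ν + ε * Real.log (3 / 2)) ∧
    VQR.supNorm (VQR.supportX ν ×ˢ VQR.supportY ν) h ≤
      VQR.costSup μ ν + VQR.supNorm μ.support g * VQR.boundX ν := by
  set C := VQR.costSup μ ν with hCdef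
  set M := VQR.boundX ν with hMdef
  obtain ⟨hfi, hgi, hhi⟩ := hdual.1
  have hC0 : 0 ≤ C := VQR.costSup_nonneg hU hY
  have hM0 : 0 ≤ M := VQR.boundX_nonneg hX
  have hmem := VQR.ae_mem_supports (ν := ν)
  have hS : IsCompact (VQR.supportX ν ×ˢ VQR.supportY ν) := hX.prod hY
  have hcont := VQR.continuousOn_logDensity (ε := ε) hfc hgc hhc
  have hfoc := fun (a : ℝ) (v : VQR.Vec dx) (u : VQR.Vec dy) (hu : u ∈ μ.support) =>
    hdual.integral_exp_mul_eq hε hU hX hY hfc hgc hhc a v hu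
  have hfoc1 : ∀ u ∈ μ.support, ∫ p, Real.exp (VQR.logDensity ε f g h (u, p)) ∂ν = 1 :=
    fun u hu => by simpa using hfoc 1 0 u hu
  have hint : Integrable (fun z => Real.exp (VQR.logDensity ε f g h z)) (μ.prod ν) := by
    refine VQR.integrable_of_continuousOn_of_ae_mem (hU.prod hS) ?_
      (Real.continuous_exp.comp_continuousOn hcont)
      (Real.continuous_exp.comp_aestronglyMeasurable
        (VQR.aestronglyMeasurable_logDensity hfi.1 hgi.1 hhi.1))
    have h1 : ∀ᵐ z ∂(μ.prod ν), z.1 ∈ μ.support :=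
      Measure.quasiMeasurePreserving_fst.ae Measure.support_mem_ae
    have h2 : ∀ᵐ z ∂(μ.prod ν), z.2 ∈ VQR.supportX ν ×ˢ VQR.supportY ν :=
      Measure.quasiMeasurePreserving_snd.ae hmem
    filter_upwards [h1, h2] with z hz1 hz2 using ⟨hz1, hz2⟩
  have hh0 : 0 ≤ ∫ p, h p ∂ν := hdual.integral_nonneg hε hint hf0 hfoc1
  have hhC : ∀ x ∈ VQR.supportX ν, ∀ y ∈ VQR.supportY ν, h (x, y) ≤ C := fun x hx y hy => by
    rw [hver x hx y hy]
    exact VQR.potential_le_costSup hε hU hY hfi hgi hfc hgc hf0 hg0 x hy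
  have hhCae : ∀ᵐ p ∂ν, h p ≤ C := hmem.mono fun p hp => hhC p.1 hp.1 p.2 hp.2
  have hwc : ∀ u ∈ μ.support, ContinuousOn (fun p => VQR.logDensity ε f g h (u, p))
      (VQR.supportX ν ×ˢ VQR.supportY ν) :=
    fun u hu => hcont.comp (by fun_prop) fun p hp => ⟨hu, hp⟩
  have hwm := fun u => VQR.aestronglyMeasurable_logDensity_right (ε := ε) (f := f) (g := g) hhi.1 u
  have hwi : ∀ u ∈ μ.support, Integrable (fun p => VQR.logDensity ε f g h (u, p)) ν :=
    fun u hu => VQR.integrable_of_continuousOn_of_ae_mem hS hmem (hwc u hu) (hwm u)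
  have hewc : ∀ u ∈ μ.support, ContinuousOn (fun p => Real.exp (VQR.logDensity ε f g h (u, p)))
      (VQR.supportX ν ×ˢ VQR.supportY ν) :=
    fun u hu => Real.continuous_exp.comp_continuousOn (hwc u hu)
  have hewm := fun u => Real.continuous_exp.comp_aestronglyMeasurable (hwm u)
  have hewi : ∀ u ∈ μ.support, Integrable (fun p => Real.exp (VQR.logDensity ε f g h (u, p))) ν :=
    fun u hu => VQR.integrable_of_continuousOn_of_ae_mem hS hmem (hewc u hu) (hewm u)
  have hflow : ∀ u ∈ μ.support, -C ≤ f u := fun u hu => by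
    have hlin : Continuous fun p : VQR.Vec dx × VQR.Vec dy => f u + C + inner ℝ (g u) p.1 := by
      fun_prop
    exact VQR.neg_le_of_moment_conditions hε hhCae (hewi u hu)
      (VQR.integrable_of_continuousOn_of_ae_mem hS hmem ((hewc u hu).mul (hwc u hu))
        ((hewm u).mul (hwm u)))
      (VQR.integrable_of_continuousOn_of_ae_mem hS hmem ((hewc u hu).mul hlin.continuousOn)
        ((hewm u).mul hlin.aestronglyMeasurable))
      fun a v => hfoc a v u hu
  have hgibbs : ∀ u ∈ μ.support, ∀ (b : VQR.Vec dx) (r : ℝ), 0 ≤ r → r < 1 →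
      (∀ x ∈ VQR.supportX ν, |inner ℝ b x| ≤ r) →
      f u + inner ℝ (g u)
        (Matrix.toEuclideanCLM (n := Fin dx) (𝕜 := ℝ) (VQR.secondMoment ν) b)
        ≤ (1 + r) * C + ε * Real.log (1 + r) := fun u hu b r hr0 hr1 hb =>
    VQR.add_inner_secondMoment_le hε hX hmean hr0 hr1 hb hhi hh0 hhCae
      (hmem.mono fun p hp => VQR.cost_le_costSup hU hY hu hp.2) (hwi u hu) (hewi u hu)
      (hfoc1 u hu)
  have hfup : ∀ u ∈ μ.support, f u ≤ C := fun u hu => by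
    simpa using hgibbs u hu 0 0 le_rfl one_pos (by simp)
  have hlog : 0 ≤ Real.log (3 / 2) := Real.log_nonneg (by norm_num)
  have hgb : ∀ u ∈ μ.support, ‖g u‖ ≤ 2 * VQR.opNorm (VQR.secondMoment ν)⁻¹ * M *
      (5 / 2 * C + ε * Real.log (3 / 2)) := fun u hu => by
    refine VQR.norm_le_of_forall_mul_sq_le (norm_nonneg _) (norm_nonneg _) hM0 (by positivity) ?_
    intro t ht0 ht
    set T := Matrix.toEuclideanCLM (n := Fin dx) (𝕜 := ℝ) (VQR.secondMoment ν)⁻¹ with hT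
    have hTT : Matrix.toEuclideanCLM (n := Fin dx) (𝕜 := ℝ) (VQR.secondMoment ν) (T (g u))
        = g u := by
      rw [hT, ← mul_apply_eq_comp, ← map_mul,
        Matrix.mul_nonsing_inv _ ((Matrix.isUnit_iff_isUnit_det _).1 hSigma), map_one,
        one_apply_eq_self]
    -- Here `b = t Σ_X⁻¹ g(u)`, so the pairing becomes `t ‖g(u)‖²`. The choice `r = 1/2` gives `3/2
    -- C + ε log (3/2)`, and `-f(u) ≤ C` raises `3/2` to `5/2`.
    have h1 := hgibbs u hu (t • T (g u)) (1 / 2) (by norm_num) (by norm_num) fun x hx => by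
      refine (abs_real_inner_le_norm _ _).trans (le_trans ?_ ht)
      rw [norm_smul, Real.norm_of_nonneg ht0]
      exact mul_le_mul (mul_le_mul_of_nonneg_left (T.le_opNorm _) ht0)
        (VQR.norm_le_boundX hX hx) (norm_nonneg _)
        (mul_nonneg ht0 (mul_nonneg (norm_nonneg _) (norm_nonneg _)))
    rw [map_smul, hTT, real_inner_smul_right, real_inner_self_eq_norm_sq] at h1
    norm_num at h1
    linarith [hflow u hu]
  obtain ⟨u₀, hu₀⟩ := Measure.nonempty_support (IsProbabilityMeasure.ne_zero μ)
  obtain ⟨x₀, hx₀⟩ := Measure.nonempty_support (IsProbabilityMeasure.ne_zero ν.fst)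
  obtain ⟨y₀, hy₀⟩ := Measure.nonempty_support (IsProbabilityMeasure.ne_zero ν.snd)
  have : Nonempty μ.support := ⟨⟨u₀, hu₀⟩⟩
  have : Nonempty (VQR.supportX ν ×ˢ VQR.supportY ν : Set (VQR.Vec dx × VQR.Vec dy)) :=
    ⟨⟨(x₀, y₀), hx₀, hy₀⟩⟩
  refine ⟨ciSup_le fun u => abs_le.2 ⟨hflow u u.2, hfup u u.2⟩, ciSup_le fun u => hgb u u.2,
    ciSup_le fun p => abs_le.2 ⟨?_, ?_⟩⟩
  -- The formula for `h` holds at every point of `𝒳 × 𝒴`, so an upper bound on `f + ⟨g, x⟩` over `𝒰`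
  -- suffices.
  · rw [show h p = h (p.1.1, p.1.2) from rfl, hver _ p.2.1 _ p.2.2]
    refine VQR.neg_le_potential hε hfi hgi hfc hgc hU _ _ fun u hu => ?_
    have h1 := (le_abs_self _).trans (abs_real_inner_le_norm (g u) p.1.1)
    have h2 := mul_le_mul (VQR.norm_le_supNorm hU hgc hu) (VQR.norm_le_boundX hX p.2.1)
      (norm_nonneg _) ((norm_nonneg _).trans (VQR.norm_le_supNorm hU hgc hu))
    linarith [hfup u hu]
  · have h1 := (norm_nonneg _).trans (VQR.norm_le_supNorm hU hgc hu₀)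
    exact (hhC _ p.2.1 _ p.2.2).trans (le_add_of_nonneg_right (mul_nonneg h1 hM0))
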